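/- Let $0<\varepsilon\le 1$ and $1<p\le 2$, and set $c(\varepsilon,p)=\frac14\,\varepsilon^{2(p+1)/p}(p-1)$. Let $n$ be a positive integer with $n\ge 2/c(\varepsilon,p)$, let $X_1,\dots,X_n$ be independent random variables on a probability space $(\Omega,\mathcal F,\mathbb P)$, with values in arbitrary measurable spaces $E_1,\dots,E_n$, and let $Y=F(X_1,\dots,X_n)$, where $F\colon E_1\times\cdots\times E_n\to\mathbb R$ is measurable and $\mathbb E(|Y|^p)\le 1$. Then there exists an interval $J$ of $\{1,\dots,n\}$ with $J^{\mathsf c}=\{1,\dots,n\}\setminus J\ne\emptyset$ and $|J|\ge c(\varepsilon,p)\,n$ such that for every nonempty $I\subseteq J$ we have $$\mathbb P\big(|\mathbb E(Y\mid\mathcal F_I)-\mathbb E(Y)|\le\varepsilon\big)\ge 1-\varepsilon,$$ where $\mathcal F_I=\sigma(\{X_i:i\in I\})$. -/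

import Mathlib

open MeasureTheory ProbabilityTheory

/-- The constant `c(ε, p) = (1/4) ε ^ (2(p+1)/p) (p - 1)`. -/
noncomputable def concentrationConst (ε p : ℝ) : ℝ :=
  1 / 4 * ε ^ (2 * (p + 1) / p) * (p - 1)

/-- The σ-algebra `σ({X i : i ∈ I})` generated by the random variables `X i` with `i ∈ I`. -/
abbrev sigmaGenerated {n : ℕ} {Ω : Type*} {E : Fin n → Type*} [mE : ∀ i, MeasurableSpace (E i)]
    (X : (i : Fin n) → Ω → E i) (I : Finset (Fin n)) : MeasurableSpace Ω :=
  ⨆ i ∈ I, (mE i).comap (X i)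

/-!
Reveal the variables in `N` consecutive blocks of `L` coordinates. The conditional expectations of
`Y` form a martingale in `L^p`, and its increments `d i` satisfy the substitute for orthogonality
`(p - 1) ∑ ‖d i‖ ^ 2 ≤ ‖Y‖ ^ 2 ≤ 1` (`sum_lpNorm_condExp_sub_sq_le`). By pigeonhole some block `J`
has `(p - 1) N ‖d i‖ ^ 2 ≤ 1`. For `I ⊆ J`, conditioning `d i` on the variables in `I` yields
`P[Y | X I] - P[Y]` (`lpNorm_condExp_sub_integral_le`), so this difference has `L^p` norm at most
`‖d i‖` and Markov's inequality applies. With `c` the given constant, `L = ⌈c n⌉` and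
`N = ⌈1 / (4 c)⌉` satisfy `N L ≤ n`, and `‖d i‖ ^ 2 ≤ 4 c / (p - 1) = ε ^ (2 (p + 1) / p)` is what
Markov's inequality needs.

The martingale inequality is the iteration of the Ricard–Xu inequality
`‖μ[f | m]‖ ^ 2 + (p - 1) ‖f - μ[f | m]‖ ^ 2 ≤ ‖f‖ ^ 2` (`lpNorm_condExp_sq_add_le`). That one
follows from the 2-uniform convexity of `L^p` with constant `p - 1` (`two_mul_lpNorm_sq_add_le`) and
the contractivity of conditional expectation by a dyadic convexity argument (`add_le_of_doubling`).
Uniform convexity in turn is the two-point inequality for real numbers (`rpow_sq_add_mul_sq_le`),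
integrated with the help of reverse Minkowski in `L^(p/2)`.
-/

/-! ### The two-point inequality -/

/-- The first derivative of `s ↦ (1 + s) ^ p + (1 - s) ^ p - p (p - 1) s ^ 2` is nonnegative
(with `q = p - 1`): the next derivative is, by AM-GM and `(1 - s ^ 2) ^ (q - 1) ≥ 1`. -/
theorem two_mul_le_one_add_rpow_sub_one_sub_rpow {q s : ℝ} (hq0 : 0 < q) (hq1 : q ≤ 1)
    (hs0 : 0 ≤ s) (hs1 : s ≤ 1) : 2 * q * s ≤ (1 + s) ^ q - (1 - s) ^ q := by
  have hd : ∀ x ∈ Set.Ioo (0 : ℝ) 1,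
      HasDerivAt (fun s : ℝ => (1 + s) ^ q - (1 - s) ^ q - 2 * q * s)
        (q * ((1 + x) ^ (q - 1) + (1 - x) ^ (q - 1) - 2)) x := by
    intro x hx
    have h1 : HasDerivAt (fun s : ℝ => (1 + s) ^ q) (1 * q * (1 + x) ^ (q - 1)) x :=
      ((hasDerivAt_id' x).const_add 1).rpow_const (Or.inl (by linarith [hx.1]))
    have h2 : HasDerivAt (fun s : ℝ => (1 - s) ^ q) (-1 * q * (1 - x) ^ (q - 1)) x :=
      ((hasDerivAt_id' x).const_sub 1).rpow_const (Or.inl (by linarith [hx.2]))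
    have h3 : HasDerivAt (fun s : ℝ => 2 * q * s) (2 * q * 1) x :=
      (hasDerivAt_id' x).const_mul _
    exact ((h1.sub h2).sub h3).congr_deriv (by ring)
  have hmono : MonotoneOn (fun s : ℝ => (1 + s) ^ q - (1 - s) ^ q - 2 * q * s)
      (Set.Icc 0 1) := by
    refine monotoneOn_of_deriv_nonneg (convex_Icc 0 1) ?_ ?_ ?_
    · refine Continuous.continuousOn ?_
      refine ((Continuous.rpow_const (by fun_prop) fun _ => Or.inr hq0.le).sub
        (Continuous.rpow_const (by fun_prop) fun _ => Or.inr hq0.le)).sub (by fun_prop)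
    · rw [interior_Icc]
      exact fun x hx => (hd x hx).differentiableAt.differentiableWithinAt
    · rw [interior_Icc]
      intro x hx
      rw [(hd x hx).deriv]
      have hu : 0 < (1 + x) ^ (q - 1) := Real.rpow_pos_of_pos (by linarith [hx.1]) _
      have hv : 0 < (1 - x) ^ (q - 1) := Real.rpow_pos_of_pos (by linarith [hx.2]) _
      -- The exponent `q - 1` is nonpositive and the base `1 - x ^ 2` is at most `1`.
      have huv : 1 ≤ (1 + x) ^ (q - 1) * (1 - x) ^ (q - 1) := by
        rw [← Real.mul_rpow (by linarith [hx.1]) (by linarith [hx.2])]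
        exact Real.one_le_rpow_of_pos_of_le_one_of_nonpos
          (mul_pos (by linarith [hx.1]) (by linarith [hx.2]))
          (by nlinarith [sq_nonneg x]) (by linarith)
      refine mul_nonneg hq0.le ?_
      nlinarith [sq_nonneg ((1 + x) ^ (q - 1) - (1 - x) ^ (q - 1))]
  have := hmono (Set.left_mem_Icc.2 zero_le_one) ⟨hs0, hs1⟩ hs0
  simp only [add_zero, sub_zero, Real.one_rpow, mul_zero, sub_self] at this
  linarith

theorem two_add_le_one_add_rpow_add_one_sub_rpow {p s : ℝ} (hp1 : 1 < p) (hp2 : p ≤ 2)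
    (hs0 : 0 ≤ s) (hs1 : s ≤ 1) : 2 + p * (p - 1) * s ^ 2 ≤ (1 + s) ^ p + (1 - s) ^ p := by
  have hd : ∀ x ∈ Set.Ioo (0 : ℝ) 1,
      HasDerivAt (fun s : ℝ => (1 + s) ^ p + (1 - s) ^ p - p * (p - 1) * s ^ 2)
        (p * ((1 + x) ^ (p - 1) - (1 - x) ^ (p - 1) - 2 * (p - 1) * x)) x := by
    intro x hx
    have h1 : HasDerivAt (fun s : ℝ => (1 + s) ^ p) (1 * p * (1 + x) ^ (p - 1)) x :=
      ((hasDerivAt_id' x).const_add 1).rpow_const (Or.inl (by linarith [hx.1]))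
    have h2 : HasDerivAt (fun s : ℝ => (1 - s) ^ p) (-1 * p * (1 - x) ^ (p - 1)) x :=
      ((hasDerivAt_id' x).const_sub 1).rpow_const (Or.inl (by linarith [hx.2]))
    have h3 : HasDerivAt (fun s : ℝ => p * (p - 1) * s ^ 2) (p * (p - 1) * (2 * x)) x := by
      simpa using (hasDerivAt_pow 2 x).const_mul (p * (p - 1))
    exact ((h1.add h2).sub h3).congr_deriv (by ring)
  have hmono : MonotoneOn (fun s : ℝ => (1 + s) ^ p + (1 - s) ^ p - p * (p - 1) * s ^ 2)
      (Set.Icc 0 1) := by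
    refine monotoneOn_of_deriv_nonneg (convex_Icc 0 1) ?_ ?_ ?_
    · refine Continuous.continuousOn ?_
      refine ((Continuous.rpow_const (by fun_prop) fun _ => Or.inr (by linarith)).add
        (Continuous.rpow_const (by fun_prop) fun _ => Or.inr (by linarith))).sub (by fun_prop)
    · rw [interior_Icc]
      exact fun x hx => (hd x hx).differentiableAt.differentiableWithinAt
    · rw [interior_Icc]
      intro x hx
      rw [(hd x hx).deriv]
      have := two_mul_le_one_add_rpow_sub_one_sub_rpow (q := p - 1) (by linarith) (by linarith)
        hx.1.le hx.2.le
      exact mul_nonneg (by linarith) (by linarith)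
  have := hmono (Set.left_mem_Icc.2 zero_le_one) ⟨hs0, hs1⟩ hs0
  simp only [add_zero, sub_zero, Real.one_rpow, ne_eq, OfNat.ofNat_ne_zero, not_false_eq_true,
    zero_pow, mul_zero] at this
  linarith

/-- The two-point inequality, that is, 2-uniform convexity of `ℓ^p` averages of two reals with the
optimal constant `p - 1`. By homogeneity and symmetry it is the case `x = 1`, `0 ≤ y ≤ 1`, where
Bernoulli's inequality bounds the left-hand side by `1 + p (p - 1) y ^ 2 / 2`. -/
theorem rpow_sq_add_mul_sq_le {p x y : ℝ} (hp1 : 1 < p) (hp2 : p ≤ 2) :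
    (x ^ 2 + (p - 1) * y ^ 2) ^ (p / 2) ≤ (|x + y| ^ p + |x - y| ^ p) / 2 := by
  -- The right-hand side depends on `|x|` and `|y|` only, and symmetrically so.
  have key : ∀ a b : ℝ, 0 ≤ b → b ≤ a →
      (a ^ 2 + (p - 1) * b ^ 2) ^ (p / 2) ≤ ((a + b) ^ p + (a - b) ^ p) / 2 := by
    intro a b hb hba
    rcases (hb.trans hba).eq_or_lt with ha | ha
    · have hb0 : b = 0 := by linarith
      subst ha hb0
      simp [Real.zero_rpow (show p ≠ 0 by linarith), Real.zero_rpow (show p / 2 ≠ 0 by linarith)]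
    · obtain ⟨s, rfl⟩ : ∃ s, b = a * s := ⟨b / a, by field_simp⟩
      have hs0 : 0 ≤ s := nonneg_of_mul_nonneg_right hb ha
      have hs1 : s ≤ 1 := by nlinarith
      have e1 : a ^ 2 + (p - 1) * (a * s) ^ 2 = a ^ 2 * (1 + (p - 1) * s ^ 2) := by ring
      have e2 : (a ^ 2) ^ (p / 2) = a ^ p := by
        rw [← Real.rpow_natCast, ← Real.rpow_mul ha.le]
        congr 1; push_cast; ring
      have e3 : a + a * s = a * (1 + s) := by ring
      have e4 : a - a * s = a * (1 - s) := by ring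
      have hns : 0 ≤ (p - 1) * s ^ 2 := mul_nonneg (by linarith) (sq_nonneg s)
      rw [e1, e3, e4, Real.mul_rpow (by positivity) (by linarith), e2,
        Real.mul_rpow ha.le (by linarith), Real.mul_rpow ha.le (by linarith), ← mul_add,
        mul_div_assoc]
      refine mul_le_mul_of_nonneg_left ?_ (by positivity)
      have h1 := rpow_one_add_le_one_add_mul_self (s := (p - 1) * s ^ 2) (by linarith)
        (p := p / 2) (by linarith) (by linarith)
      have h2 := two_add_le_one_add_rpow_add_one_sub_rpow hp1 hp2 hs0 hs1
      linarith
  have hsymm : |x + y| ^ p + |x - y| ^ p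
      = (|x| + |y|) ^ p + |(|x| - |y|)| ^ p := by
    rcases le_total 0 x with hx | hx <;> rcases le_total 0 y with hy | hy
    · rw [abs_of_nonneg hx, abs_of_nonneg hy, abs_of_nonneg (add_nonneg hx hy)]
    · rw [abs_of_nonneg hx, abs_of_nonpos hy, ← sub_eq_add_neg, sub_neg_eq_add,
        abs_of_nonneg (show 0 ≤ x - y by linarith), add_comm]
    · rw [abs_of_nonpos hx, abs_of_nonneg hy, abs_of_nonpos (show x - y ≤ 0 by linarith),
        show -x - y = -(x + y) by ring, abs_neg, show -(x - y) = -x + y by ring, add_comm]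
    · rw [abs_of_nonpos hx, abs_of_nonpos hy, abs_of_nonpos (add_nonpos hx hy),
        show -x - -y = -(x - y) by ring, abs_neg, neg_add]
  rw [hsymm, ← sq_abs x, ← sq_abs y]
  rcases le_total |y| |x| with h | h
  · rw [abs_of_nonneg (sub_nonneg.2 h)]
    exact key _ _ (abs_nonneg y) h
  · rw [abs_of_nonpos (sub_nonpos.2 h), neg_sub, add_comm |x|]
    refine le_trans ?_ (key _ _ (abs_nonneg x) h)
    have h2 : |x| ^ 2 ≤ |y| ^ 2 := pow_le_pow_left₀ (abs_nonneg x) h 2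
    exact Real.rpow_le_rpow (add_nonneg (sq_nonneg _) (mul_nonneg (by linarith) (sq_nonneg _)))
      (by nlinarith) (by linarith)

/-! ### Uniform convexity of `L^p` -/

/-- Pointwise form of the reverse Minkowski inequality in `L^r`, `0 < r ≤ 1`: for each fixed
weight `l` the left-hand side is linear in `(u ^ r, v ^ r)`, hence can be integrated. -/
theorem rpow_mul_rpow_add_le_add_rpow {r u v l : ℝ} (hr0 : 0 < r) (hr1 : r ≤ 1)
    (hu : 0 ≤ u) (hv : 0 ≤ v) (hl0 : 0 ≤ l) (hl1 : l ≤ 1) :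
    l ^ (1 - r) * u ^ r + (1 - l) ^ (1 - r) * v ^ r ≤ (u + v) ^ r := by
  rcases (add_nonneg hu hv).eq_or_lt with h | h
  · have hu0 : u = 0 := by linarith
    have hv0 : v = 0 := by linarith
    simp [hu0, hv0, Real.zero_rpow hr0.ne']
  · set w := u / (u + v) with hw
    have eu : u = (u + v) * w := by rw [hw]; field_simp
    have ev : v = (u + v) * (1 - w) := by rw [hw]; field_simp; ring
    have hw0 : 0 ≤ w := by positivity
    have hw1 : w ≤ 1 := by rw [hw, div_le_one h]; linarith
    have h1 := Real.geom_mean_le_arith_mean2_weighted (sub_nonneg.2 hr1) hr0.le hl0 hw0 (by ring)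
    have h2 := Real.geom_mean_le_arith_mean2_weighted (sub_nonneg.2 hr1) hr0.le
      (sub_nonneg.2 hl1) (sub_nonneg.2 hw1) (by ring)
    have eu' : u ^ r = (u + v) ^ r * w ^ r := by rw [← Real.mul_rpow h.le hw0, ← eu]
    have ev' : v ^ r = (u + v) ^ r * (1 - w) ^ r := by
      rw [← Real.mul_rpow h.le (sub_nonneg.2 hw1), ← ev]
    rw [eu', ev']
    calc _ = (u + v) ^ r * (l ^ (1 - r) * w ^ r + (1 - l) ^ (1 - r) * (1 - w) ^ r) := by ring
      _ ≤ (u + v) ^ r * 1 := by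
        refine mul_le_mul_of_nonneg_left ?_ (by positivity)
        linarith
      _ = _ := mul_one _

theorem lpNorm_rpow_eq_integral {α : Type*} {m0 : MeasurableSpace α} {μ : Measure α}
    {f : α → ℝ} {p : ℝ} (hp : 0 < p) (hf : MemLp f (ENNReal.ofReal p) μ) :
    lpNorm f (ENNReal.ofReal p) μ ^ p = ∫ x, |f x| ^ p ∂μ := by
  rw [lpNorm_eq_integral_norm_rpow_toReal (by simpa using hp) ENNReal.ofReal_ne_top hf.1,
    ENNReal.toReal_ofReal hp.le, Real.rpow_inv_rpow (integral_nonneg fun x => by positivity) hp.ne']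
  rfl

/-- The Ball–Carlen–Lieb inequality: `L^p` is 2-uniformly convex with constant `p - 1`. -/
theorem two_mul_lpNorm_sq_add_le {α : Type*} {m0 : MeasurableSpace α} {μ : Measure α}
    {f g : α → ℝ} {p : ℝ} (hp1 : 1 < p) (hp2 : p ≤ 2)
    (hf : MemLp f (ENNReal.ofReal p) μ) (hg : MemLp g (ENNReal.ofReal p) μ) :
    2 * (lpNorm f (ENNReal.ofReal p) μ ^ 2 + (p - 1) * lpNorm g (ENNReal.ofReal p) μ ^ 2)
      ≤ lpNorm (f + g) (ENNReal.ofReal p) μ ^ 2 + lpNorm (f - g) (ENNReal.ofReal p) μ ^ 2 := by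
  have hp0 : 0 < p := by linarith
  have hint : ∀ h : α → ℝ, MemLp h (ENNReal.ofReal p) μ → Integrable (fun x => |h x| ^ p) μ := by
    intro h hh
    have := hh.integrable_norm_rpow (by simpa using hp0) ENNReal.ofReal_ne_top
    rwa [ENNReal.toReal_ofReal hp0.le] at this
  have sq_rpow : ∀ a : ℝ, 0 ≤ a → (a ^ 2) ^ (p / 2) = a ^ p := by
    intro a ha
    rw [← Real.rpow_natCast, ← Real.rpow_mul ha]
    congr 1; push_cast; ring
  have hIf := lpNorm_rpow_eq_integral hp0 hf
  have hIg := lpNorm_rpow_eq_integral hp0 hg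
  have hIa := lpNorm_rpow_eq_integral hp0 (hf.add hg)
  have hIs := lpNorm_rpow_eq_integral hp0 (hf.sub hg)
  have hNf : 0 ≤ lpNorm f (ENNReal.ofReal p) μ := lpNorm_nonneg
  have hNg : 0 ≤ lpNorm g (ENNReal.ofReal p) μ := lpNorm_nonneg
  have hNa : 0 ≤ lpNorm (f + g) (ENNReal.ofReal p) μ := lpNorm_nonneg
  have hNs : 0 ≤ lpNorm (f - g) (ENNReal.ofReal p) μ := lpNorm_nonneg
  set a := lpNorm f (ENNReal.ofReal p) μ
  set b := lpNorm g (ENNReal.ofReal p) μ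
  set c := lpNorm (f + g) (ENNReal.ofReal p) μ
  set d := lpNorm (f - g) (ENNReal.ofReal p) μ
  set r := p / 2 with hr
  have hr0 : 0 < r := by linarith
  have hr1 : r ≤ 1 := by linarith
  have hB : 0 ≤ (p - 1) * b ^ 2 := mul_nonneg (by linarith) (sq_nonneg b)
  set S := a ^ 2 + (p - 1) * b ^ 2 with hS
  have hS0 : 0 ≤ S := add_nonneg (sq_nonneg a) hB
  rcases hS0.eq_or_lt with h0 | hSpos
  · rw [← h0]; nlinarith [sq_nonneg c, sq_nonneg d]
  -- With this weight the integrated left-hand side of `hpt` is exactly `S ^ r`.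
  set l := a ^ 2 / S with hl
  have hl0 : 0 ≤ l := by positivity
  have hl1 : l ≤ 1 := by rw [hl, div_le_one hSpos]; linarith
  have hpt : ∀ x, l ^ (1 - r) * |f x| ^ p + (1 - l) ^ (1 - r) * (p - 1) ^ r * |g x| ^ p
      ≤ (|(f + g) x| ^ p + |(f - g) x| ^ p) / 2 := by
    intro x
    refine le_trans ?_ (rpow_sq_add_mul_sq_le (x := f x) (y := g x) hp1 hp2)
    have := rpow_mul_rpow_add_le_add_rpow hr0 hr1 (sq_nonneg (f x))
      (mul_nonneg (sub_nonneg.2 hp1.le) (sq_nonneg (g x))) hl0 hl1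
    rwa [Real.mul_rpow (by linarith) (sq_nonneg _), ← sq_abs (f x), ← sq_abs (g x),
      sq_rpow _ (abs_nonneg _), sq_rpow _ (abs_nonneg _), ← mul_assoc, sq_abs, sq_abs] at this
  have hmain : S ^ r ≤ (c ^ p + d ^ p) / 2 := by
    have hI := integral_mono (((hint f hf).const_mul (l ^ (1 - r))).add
      ((hint g hg).const_mul ((1 - l) ^ (1 - r) * (p - 1) ^ r)))
      (((hint _ (hf.add hg)).add (hint _ (hf.sub hg))).div_const 2) hpt
    simp only [Pi.add_apply] at hI
    rw [integral_add ((hint f hf).const_mul _) ((hint g hg).const_mul _), integral_const_mul,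
      integral_const_mul, integral_div] at hI
    have hadd := integral_add (hint _ (hf.add hg)) (hint _ (hf.sub hg))
    simp only [Pi.add_apply] at hadd hIa
    rw [hadd, ← hIf, ← hIg, ← hIa, ← hIs] at hI
    refine le_trans (le_of_eq ?_) hI
    have e1 : a ^ 2 = S * l := by rw [hl]; field_simp
    have e2 : (p - 1) * b ^ 2 = S * (1 - l) := by rw [mul_sub, ← e1, hS]; ring
    have e3 : a ^ p = S ^ r * l ^ r := by
      rw [← sq_rpow a hNf, e1, Real.mul_rpow hS0 hl0]
    have e4 : (p - 1) ^ r * b ^ p = S ^ r * (1 - l) ^ r := by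
      rw [← sq_rpow b hNg, ← Real.mul_rpow (by linarith) (sq_nonneg b), e2,
        Real.mul_rpow hS0 (sub_nonneg.2 hl1)]
    have one : ∀ t : ℝ, 0 ≤ t → t ^ (1 - r) * t ^ r = t := by
      intro t ht
      rw [← Real.rpow_add' ht (by simp), sub_add_cancel, Real.rpow_one]
    rw [mul_assoc, e4, e3]
    calc S ^ r = S ^ r * (l + (1 - l)) := by ring
      _ = S ^ r * (l ^ (1 - r) * l ^ r + (1 - l) ^ (1 - r) * (1 - l) ^ r) := by
        rw [one l hl0, one (1 - l) (sub_nonneg.2 hl1)]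
      _ = _ := by ring
  have hmean : (c ^ p + d ^ p) / 2 ≤ ((c ^ 2 + d ^ 2) / 2) ^ r := by
    have := (Real.concaveOn_rpow hr0.le hr1).2 (sq_nonneg c) (sq_nonneg d)
      (show (0 : ℝ) ≤ 1 / 2 by norm_num) (show (0 : ℝ) ≤ 1 / 2 by norm_num) (by norm_num)
    simp only [smul_eq_mul, sq_rpow c hNa, sq_rpow d hNs] at this
    rw [show (c ^ 2 + d ^ 2) / 2 = 1 / 2 * c ^ 2 + 1 / 2 * d ^ 2 by ring]
    linarith
  have := (Real.rpow_le_rpow_iff hS0 (by positivity) hr0).1 (hmain.trans hmean)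
  linarith

/-! ### Martingale differences in `L^p` -/

/-- A function with minimum at `0` and modulus of convexity `c t ^ 2` along doublings satisfies
`φ 0 + c ≤ φ 1`. No continuity or differentiability of `φ` is needed. -/
theorem add_le_of_doubling {φ : ℝ → ℝ} {c : ℝ} (hmin : ∀ t, φ 0 ≤ φ t)
    (hdbl : ∀ t, 2 * (φ t + c * t ^ 2) ≤ φ (2 * t) + φ 0) : φ 0 + c ≤ φ 1 := by
  -- `t ↦ (φ t - φ 0) / t - c t` does not decrease when `t` doubles.
  have hk : ∀ k : ℕ, 2 ^ k * (φ ((1 / 2) ^ k) - φ 0) - c * (1 / 2) ^ k ≤ φ 1 - φ 0 - c := by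
    intro k
    induction k with
    | zero => simp
    | succ k ih =>
      refine le_trans ?_ ih
      have h := hdbl ((1 / 2) ^ (k + 1))
      rw [show (2 : ℝ) * (1 / 2) ^ (k + 1) = (1 / 2) ^ k by ring] at h
      have h2 : (2 : ℝ) ^ k * (1 / 2) ^ k = 1 := by rw [← mul_pow]; norm_num
      have h3 := mul_le_mul_of_nonneg_left h (show (0 : ℝ) ≤ 2 ^ k by positivity)
      have h4 : (2 : ℝ) ^ k * (2 * (φ ((1 / 2) ^ (k + 1)) + c * ((1 / 2) ^ (k + 1)) ^ 2))
          = 2 ^ (k + 1) * φ ((1 / 2) ^ (k + 1))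
            + (2 ^ k * (1 / 2) ^ k) * (c * (1 / 2) ^ (k + 1)) := by
        ring
      rw [h4, h2] at h3
      have e : c * (1 / 2 : ℝ) ^ k = 2 * (c * (1 / 2) ^ (k + 1)) := by ring
      have e' : (2 : ℝ) ^ (k + 1) * φ 0 = 2 ^ k * φ 0 + 2 ^ k * φ 0 := by ring
      rw [e]
      linarith
  have hlim : Filter.Tendsto (fun k : ℕ => -(c * (1 / 2 : ℝ) ^ k)) Filter.atTop (nhds 0) := by
    simpa using ((tendsto_pow_atTop_nhds_zero_of_lt_one (r := (1 / 2 : ℝ)) (by norm_num)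
      (by norm_num)).const_mul c).neg
  have := le_of_tendsto' hlim (b := φ 1 - φ 0 - c) fun k => by
    have h := hk k
    have : 0 ≤ 2 ^ k * (φ ((1 / 2) ^ k) - φ 0) :=
      mul_nonneg (by positivity) (sub_nonneg.2 (hmin _))
    linarith
  linarith

theorem lpNorm_congr_ae {α : Type*} {m0 : MeasurableSpace α} {μ : Measure α} {f g : α → ℝ}
    {q : ENNReal} (hfg : f =ᵐ[μ] g) : lpNorm f q μ = lpNorm g q μ := by
  unfold lpNorm
  rw [aestronglyMeasurable_congr hfg, eLpNorm_congr_ae hfg]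

section CondExp

variable {Ω : Type*} {m m0 : MeasurableSpace Ω} {μ : Measure Ω} [IsFiniteMeasure μ]
  {f : Ω → ℝ} {p : ℝ}

/-- The Ricard–Xu inequality. Conditional expectation is a contraction, so
`t ↦ ‖μ[f | m] + t (f - μ[f | m])‖` is minimal at `t = 0`, and uniform convexity turns this into a
gain of `(p - 1) ‖f - μ[f | m]‖ ^ 2` at `t = 1`. -/
theorem lpNorm_condExp_sq_add_le (hm : m ≤ m0) (hp1 : 1 < p) (hp2 : p ≤ 2)
    (hf : MemLp f (ENNReal.ofReal p) μ) :
    lpNorm (μ[f | m]) (ENNReal.ofReal p) μ ^ 2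
      + (p - 1) * lpNorm (f - μ[f | m]) (ENNReal.ofReal p) μ ^ 2
      ≤ lpNorm f (ENNReal.ofReal p) μ ^ 2 := by
  have hq : 1 ≤ ENNReal.ofReal p := by simpa using hp1.le
  have ha : MemLp (μ[f | m]) (ENNReal.ofReal p) μ := hf.condExp hq
  have hb : MemLp (f - μ[f | m]) (ENNReal.ofReal p) μ := hf.sub ha
  have hmin : ∀ t : ℝ, lpNorm (μ[f | m]) (ENNReal.ofReal p) μ
      ≤ lpNorm (μ[f | m] + t • (f - μ[f | m])) (ENNReal.ofReal p) μ := by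
    intro t
    have hfi := hf.integrable hq
    have hae : μ[μ[f | m] + t • (f - μ[f | m]) | m] =ᵐ[μ] μ[f | m] := by
      have h1 := condExp_add (μ := μ) (integrable_condExp (f := f) (m := m))
        ((hfi.sub (integrable_condExp (f := f) (m := m))).smul t) m
      have h2 := condExp_smul (μ := μ) t (f - μ[f | m]) m
      have h3 := condExp_sub (μ := μ) hfi (integrable_condExp (f := f) (m := m)) m
      have h4 : μ[μ[f | m] | m] = μ[f | m] :=
        condExp_of_stronglyMeasurable hm stronglyMeasurable_condExp integrable_condExp
      rw [h4] at h1 h3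
      filter_upwards [h1, h2, h3] with x h1 h2 h3
      simp [h1, h2, h3]
    have hle := (ha.add (hb.const_smul t)).lpNorm_condExp_le_lpNorm (m := m) hq
    refine le_trans (le_of_eq ?_) hle
    exact (lpNorm_congr_ae hae).symm
  have := add_le_of_doubling
    (φ := fun t => lpNorm (μ[f | m] + t • (f - μ[f | m])) (ENNReal.ofReal p) μ ^ 2)
    (c := (p - 1) * lpNorm (f - μ[f | m]) (ENNReal.ofReal p) μ ^ 2)
    (fun t => by
      simp only [zero_smul, add_zero]
      exact pow_le_pow_left₀ lpNorm_nonneg (hmin t) 2)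
    (fun t => by
      have h := two_mul_lpNorm_sq_add_le hp1 hp2 (ha.add (hb.const_smul t)) (hb.const_smul t)
      rw [lpNorm_const_smul, add_sub_cancel_right, add_assoc, ← add_smul, ← two_mul] at h
      simp only [zero_smul, add_zero]
      refine le_trans (le_of_eq ?_) h
      simp only [coe_nnnorm, Real.norm_eq_abs, mul_pow, sq_abs]
      ring)
  simpa using this

/-- The increments of the martingale `μ[f | 𝒢 i]` are square summable in `L^p`, as if they were
orthogonal up to the factor `p - 1`. -/
theorem sum_lpNorm_condExp_sub_sq_le {𝒢 : ℕ → MeasurableSpace Ω} (hmono : Monotone 𝒢)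
    (hle : ∀ i, 𝒢 i ≤ m0) (hp1 : 1 < p) (hp2 : p ≤ 2)
    (hf : MemLp f (ENNReal.ofReal p) μ) (N : ℕ) :
    (p - 1) * ∑ i ∈ Finset.range N,
        lpNorm (μ[f | 𝒢 (i + 1)] - μ[f | 𝒢 i]) (ENNReal.ofReal p) μ ^ 2
      ≤ lpNorm f (ENNReal.ofReal p) μ ^ 2 := by
  have hq : 1 ≤ ENNReal.ofReal p := by simpa using hp1.le
  have key : (p - 1) * ∑ i ∈ Finset.range N,
        lpNorm (μ[f | 𝒢 (i + 1)] - μ[f | 𝒢 i]) (ENNReal.ofReal p) μ ^ 2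
      ≤ lpNorm (μ[f | 𝒢 N]) (ENNReal.ofReal p) μ ^ 2 := by
    induction N with
    | zero => simp
    | succ N ih =>
      have h := lpNorm_condExp_sq_add_le (hle N) hp1 hp2 (hf.condExp (m := 𝒢 (N + 1)) hq)
      have hae : μ[μ[f | 𝒢 (N + 1)] | 𝒢 N] =ᵐ[μ] μ[f | 𝒢 N] :=
        condExp_condExp_of_le (hmono N.le_succ) (hle _)
      rw [lpNorm_congr_ae hae, lpNorm_congr_ae ((Filter.EventuallyEq.refl _ _).sub hae)] at h
      rw [Finset.sum_range_succ, mul_add]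
      linarith
  exact key.trans (pow_le_pow_left₀ lpNorm_nonneg (hf.lpNorm_condExp_le_lpNorm hq) 2)

end CondExp

/-! ### Blocks of independent variables -/

/-- Markov's inequality for `|g| ^ p`. -/
theorem ofReal_one_sub_le_measure_abs_le {Ω : Type*} {m0 : MeasurableSpace Ω} {P : Measure Ω}
    [IsProbabilityMeasure P] {g : Ω → ℝ} {p ε : ℝ} (hp : 0 < p) (hε : 0 < ε)
    (hg : MemLp g (ENNReal.ofReal p) P)
    (hle : lpNorm g (ENNReal.ofReal p) P ^ p ≤ ε ^ (p + 1)) :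
    ENNReal.ofReal (1 - ε) ≤ P {ω | |g ω| ≤ ε} := by
  have hint : Integrable (fun x => |g x| ^ p) P := by
    have := hg.integrable_norm_rpow (by simpa using hp) ENNReal.ofReal_ne_top
    rwa [ENNReal.toReal_ofReal hp.le] at this
  have hM := mul_meas_ge_le_integral_of_nonneg
    (Filter.Eventually.of_forall fun x => Real.rpow_nonneg (abs_nonneg (g x)) p) hint (ε ^ p)
  rw [← lpNorm_rpow_eq_integral hp hg] at hM
  have hbad : P.real {ω | ε ^ p ≤ |g ω| ^ p} ≤ ε := by
    have h := hM.trans hle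
    rw [Real.rpow_add_one hε.ne'] at h
    exact le_of_mul_le_mul_left h (Real.rpow_pos_of_pos hε p)
  have hcover : (Set.univ : Set Ω) ⊆ {ω | |g ω| ≤ ε} ∪ {ω | ε ^ p ≤ |g ω| ^ p} := by
    intro ω _
    rcases le_total (|g ω|) ε with h | h
    · exact Or.inl h
    · exact Or.inr (Real.rpow_le_rpow hε.le h hp.le)
  have hone : 1 ≤ P.real {ω | |g ω| ≤ ε} + P.real {ω | ε ^ p ≤ |g ω| ^ p} := by
    have := (measureReal_mono hcover).trans (measureReal_union_le (μ := P) _ _)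
    rwa [probReal_univ] at this
  rw [← ofReal_measureReal]
  exact ENNReal.ofReal_le_ofReal (by linarith)

section Independent

variable {n : ℕ} {Ω : Type*} {m0 : MeasurableSpace Ω} {P : Measure Ω} [IsProbabilityMeasure P]
  {E : Fin n → Type*} [mE : ∀ i, MeasurableSpace (E i)] {X : (i : Fin n) → Ω → E i}
  {Y : Ω → ℝ} {p : ℝ}

theorem sigmaGenerated_le (hX : ∀ i, Measurable (X i)) (I : Finset (Fin n)) :
    sigmaGenerated X I ≤ m0 :=
  iSup₂_le fun i _ => (hX i).comap_le

theorem sigmaGenerated_mono {I K : Finset (Fin n)} (h : I ⊆ K) :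
    sigmaGenerated X I ≤ sigmaGenerated X K :=
  biSup_mono fun _ hi => h hi

theorem condExp_condExp_sigmaGenerated_of_disjoint (hX : ∀ i, Measurable (X i))
    (hindep : iIndepFun X P) {K I : Finset (Fin n)} (hKI : Disjoint K I) :
    P[P[Y | sigmaGenerated X K] | sigmaGenerated X I] =ᵐ[P] fun _ => ∫ ω, Y ω ∂P := by
  have hind : Indep (sigmaGenerated X K) (sigmaGenerated X I) P :=
    indep_iSup_of_disjoint (m := fun i => (mE i).comap (X i)) (fun i => (hX i).comap_le)
      hindep.iIndep (Finset.disjoint_coe.2 hKI)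
  have h := condExp_indep_eq (sigmaGenerated_le hX K) (sigmaGenerated_le hX I)
    (stronglyMeasurable_condExp (f := Y) (μ := P)) hind
  rwa [integral_condExp (sigmaGenerated_le hX K)] at h

/-- If `I` lies in `K'` and is disjoint from `K`, then projecting the increment
`P[Y | X K'] - P[Y | X K]` onto `X I` gives `P[Y | X I] - P[Y]`: the first term by the tower
property, the second by independence. -/
theorem lpNorm_condExp_sub_integral_le (hX : ∀ i, Measurable (X i)) (hindep : iIndepFun X P)
    (hp : 1 ≤ p) (hY : MemLp Y (ENNReal.ofReal p) P) {K K' I : Finset (Fin n)}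
    (hI : I ⊆ K') (hKI : Disjoint K I) :
    lpNorm (fun ω => (P[Y | sigmaGenerated X I]) ω - ∫ ω', Y ω' ∂P) (ENNReal.ofReal p) P
      ≤ lpNorm (P[Y | sigmaGenerated X K'] - P[Y | sigmaGenerated X K])
          (ENNReal.ofReal p) P := by
  have hq : 1 ≤ ENNReal.ofReal p := by simpa using hp
  have hle := ((hY.condExp (m := sigmaGenerated X K') hq).sub
    (hY.condExp (m := sigmaGenerated X K) hq)).lpNorm_condExp_le_lpNorm
      (m := sigmaGenerated X I) hq
  refine le_trans (le_of_eq (lpNorm_congr_ae ?_)) hle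
  have h1 := condExp_sub (μ := P) (integrable_condExp (f := Y) (m := sigmaGenerated X K'))
    (integrable_condExp (f := Y) (m := sigmaGenerated X K)) (sigmaGenerated X I)
  have h2 : P[P[Y | sigmaGenerated X K'] | sigmaGenerated X I] =ᵐ[P] P[Y | sigmaGenerated X I] :=
    condExp_condExp_of_le (sigmaGenerated_mono hI) (sigmaGenerated_le hX K')
  have h3 := condExp_condExp_sigmaGenerated_of_disjoint (Y := Y) hX hindep hKI
  filter_upwards [h1, h2, h3] with ω h1 h2 h3
  rw [h1, Pi.sub_apply, h2, h3]

/-- Revealing `N` consecutive blocks of `L` coordinates one after the other, some block changes the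
conditional expectation of `Y` by at most the average amount. -/
theorem exists_block_lpNorm_condExp_sub_sq_le (hX : ∀ i, Measurable (X i)) (hp1 : 1 < p)
    (hp2 : p ≤ 2) (hY : MemLp Y (ENNReal.ofReal p) P) (hY1 : lpNorm Y (ENNReal.ofReal p) P ≤ 1)
    (L : ℕ) {N : ℕ} (hN : 0 < N) :
    ∃ i < N, (p - 1) * N *
      lpNorm (P[Y | sigmaGenerated X {j : Fin n | j.val < (i + 1) * L}]
        - P[Y | sigmaGenerated X {j : Fin n | j.val < i * L}]) (ENNReal.ofReal p) P ^ 2 ≤ 1 := by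
  have hmono : Monotone fun i : ℕ => sigmaGenerated X {j : Fin n | j.val < i * L} := by
    intro i k hik
    refine sigmaGenerated_mono fun j hj => ?_
    simp only [Finset.mem_filter, Finset.mem_univ, true_and] at hj ⊢
    exact hj.trans_le (Nat.mul_le_mul_right L hik)
  have hsum := sum_lpNorm_condExp_sub_sq_le hmono (fun i => sigmaGenerated_le hX _) hp1 hp2 hY N
  have hsum1 := hsum.trans (pow_le_one₀ lpNorm_nonneg hY1)
  by_contra! hcon
  have hlt : ∑ i ∈ Finset.range N, (1 : ℝ) < ∑ i ∈ Finset.range N, (p - 1) * N *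
      lpNorm (P[Y | sigmaGenerated X {j : Fin n | j.val < (i + 1) * L}]
        - P[Y | sigmaGenerated X {j : Fin n | j.val < i * L}]) (ENNReal.ofReal p) P ^ 2 :=
    Finset.sum_lt_sum_of_nonempty (by simpa using hN.ne') fun i hi =>
      hcon i (Finset.mem_range.1 hi)
  rw [← Finset.mul_sum, mul_right_comm] at hlt
  simp only [Finset.sum_const, Finset.card_range, nsmul_eq_mul, mul_one] at hlt
  have := mul_le_mul_of_nonneg_right hsum1 (Nat.cast_nonneg (α := ℝ) N)
  linarith

end Independent

/-! ### Choice of the block length and the number of blocks -/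

theorem theorem1 (ε p : ℝ) (hε : 0 < ε) (hε1 : ε ≤ 1) (hp : 1 < p) (hp2 : p ≤ 2)
    (n : ℕ) (hn : 2 / concentrationConst ε p ≤ (n : ℝ))
    {Ω : Type*} [MeasurableSpace Ω] (P : Measure Ω) [IsProbabilityMeasure P]
    {E : Fin n → Type*} [∀ i, MeasurableSpace (E i)]
    (X : (i : Fin n) → Ω → E i) (hX : ∀ i, Measurable (X i)) (hindep : iIndepFun X P)
    (F : ((i : Fin n) → E i) → ℝ) (hF : Measurable F)
    (Y : Ω → ℝ) (hY : ∀ ω, Y ω = F (fun i => X i ω))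
    (hYp : ∫⁻ ω, ENNReal.ofReal (|Y ω| ^ p) ∂P ≤ 1) :
    ∃ J : Finset (Fin n), (J : Set (Fin n)).OrdConnected ∧ Jᶜ.Nonempty ∧
      concentrationConst ε p * (n : ℝ) ≤ (J.card : ℝ) ∧
      ∀ I : Finset (Fin n), I.Nonempty → I ⊆ J →
        ENNReal.ofReal (1 - ε) ≤
          P {ω | |(P[Y | sigmaGenerated X I]) ω - ∫ ω', Y ω' ∂P| ≤ ε} := by
  have hp0 : 0 < p := by linarith
  have hYm : Measurable Y := by
    rw [funext hY]
    exact hF.comp (measurable_pi_lambda _ hX)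
  have hnorm : eLpNorm Y (ENNReal.ofReal p) P ≤ 1 := by
    rw [eLpNorm_eq_lintegral_rpow_enorm_toReal (by simpa using hp0) ENNReal.ofReal_ne_top,
      ENNReal.toReal_ofReal hp0.le]
    refine ENNReal.rpow_le_one ?_ (by positivity)
    refine le_trans (le_of_eq (lintegral_congr fun ω => ?_)) hYp
    rw [← ofReal_norm, Real.norm_eq_abs, ENNReal.ofReal_rpow_of_nonneg (abs_nonneg _) hp0.le]
  have hYL : MemLp Y (ENNReal.ofReal p) P :=
    ⟨hYm.aestronglyMeasurable, hnorm.trans_lt ENNReal.one_lt_top⟩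
  have hY1 : lpNorm Y (ENNReal.ofReal p) P ≤ 1 := by
    rw [← toReal_eLpNorm hYL.1]
    exact ENNReal.toReal_le_of_le_ofReal zero_le_one (by simpa using hnorm)
  set e := ε ^ (2 * (p + 1) / p) with he
  have he0 : 0 < e := Real.rpow_pos_of_pos hε _
  have he1 : e ≤ 1 := Real.rpow_le_one hε.le hε1 (by positivity)
  set c := concentrationConst ε p with hc
  have hce : 4 * c = e * (p - 1) := by rw [hc, concentrationConst]; ring
  have hc0 : 0 < c := by nlinarith [mul_pos he0 (sub_pos.2 hp)]
  have hc1 : 4 * c ≤ 1 := by rw [hce]; nlinarith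
  have hcn : 2 ≤ c * n := by rwa [div_le_iff₀' hc0] at hn
  obtain ⟨L, hL, hL'⟩ : ∃ L : ℕ, c * n ≤ L ∧ (L : ℝ) < c * n + 1 :=
    ⟨⌈c * n⌉₊, Nat.le_ceil _, Nat.ceil_lt_add_one (by linarith)⟩
  obtain ⟨N, hN, hN'⟩ : ∃ N : ℕ, 1 / (4 * c) ≤ N ∧ (N : ℝ) < 1 / (4 * c) + 1 :=
    ⟨⌈1 / (4 * c)⌉₊, Nat.le_ceil _, Nat.ceil_lt_add_one (by positivity)⟩
  rw [div_le_iff₀ (by positivity)] at hN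
  have hNc : (N : ℝ) * (4 * c) ≤ 2 := by
    rw [← sub_lt_iff_lt_add, lt_div_iff₀ (by positivity)] at hN'
    linarith
  have hN0 : 0 < N := by
    rcases Nat.eq_zero_or_pos N with h | h
    · rw [h] at hN; norm_num at hN
    · exact h
  have hn0 : (0 : ℝ) < n := by
    by_contra h
    nlinarith
  have hNL : N * L ≤ n := by
    have hL2 : (L : ℝ) ≤ 3 / 2 * (c * n) := by linarith
    have : (N : ℝ) * L ≤ n := by
      calc (N : ℝ) * L ≤ N * (3 / 2 * (c * n)) :=
            mul_le_mul_of_nonneg_left hL2 (Nat.cast_nonneg _)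
        _ = (N * (4 * c)) * (3 / 8 * n) := by ring
        _ ≤ 2 * (3 / 8 * n) := mul_le_mul_of_nonneg_right hNc (by positivity)
        _ ≤ n := by linarith
    exact_mod_cast this
  have hLn : L < n := by
    have : (L : ℝ) < n := by nlinarith
    exact_mod_cast this
  obtain ⟨i, hiN, hi⟩ := exists_block_lpNorm_condExp_sub_sq_le hX hp hp2 hYL hY1 L hN0
  have hin : (i + 1) * L ≤ n := (Nat.mul_le_mul_right L hiN).trans hNL
  set J : Finset (Fin n) := (Finset.Ico (i * L) ((i + 1) * L)).attachFin
    (fun k hk => (Finset.mem_Ico.1 hk).2.trans_le hin) with hJ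
  have hmem : ∀ j : Fin n, j ∈ J ↔ i * L ≤ j.val ∧ j.val < (i + 1) * L := by
    intro j; rw [hJ, Finset.mem_attachFin, Finset.mem_Ico]
  have hcard : J.card = L := by
    rw [hJ, Finset.card_attachFin, Nat.card_Ico, ← Nat.sub_mul]; simp
  refine ⟨J, ⟨fun x hx y hy z hz => ?_⟩, ?_, by rwa [hcard], fun I _ hIJ => ?_⟩
  · rw [Finset.mem_coe, hmem] at hx hy ⊢
    exact ⟨hx.1.trans hz.1, lt_of_le_of_lt hz.2 hy.2⟩
  · rw [← Finset.card_pos, Finset.card_compl, Fintype.card_fin, hcard]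
    omega
  · have hq : 1 ≤ ENNReal.ofReal p := by simpa using hp.le
    refine ofReal_one_sub_le_measure_abs_le hp0 hε
      ((hYL.condExp hq).sub (memLp_const (∫ ω', Y ω' ∂P))) ?_
    have hle := lpNorm_condExp_sub_integral_le hX hindep hp.le hYL (I := I)
      (K := {j : Fin n | j.val < i * L}) (K' := {j : Fin n | j.val < (i + 1) * L})
      (fun j hj => by simpa using ((hmem j).1 (hIJ hj)).2)
      (Finset.disjoint_left.2 fun j hj hjI => by
        have h1 := ((hmem j).1 (hIJ hjI)).1
        have h2 : j.val < i * L := by simpa using hj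
        omega)
    refine (Real.rpow_le_rpow lpNorm_nonneg hle hp0.le).trans ?_
    have hd0 : 0 ≤ lpNorm (P[Y | sigmaGenerated X {j : Fin n | j.val < (i + 1) * L}]
        - P[Y | sigmaGenerated X {j : Fin n | j.val < i * L}]) (ENNReal.ofReal p) P :=
      lpNorm_nonneg
    set d := lpNorm (P[Y | sigmaGenerated X {j : Fin n | j.val < (i + 1) * L}]
        - P[Y | sigmaGenerated X {j : Fin n | j.val < i * L}]) (ENNReal.ofReal p) P
    have hde : d ^ 2 ≤ e := by
      have h1 : 1 ≤ e * ((p - 1) * N) := by rw [hce] at hN; linarith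
      calc d ^ 2 ≤ e * ((p - 1) * N) * d ^ 2 := le_mul_of_one_le_left (sq_nonneg d) h1
        _ = e * ((p - 1) * N * d ^ 2) := by ring
        _ ≤ e * 1 := mul_le_mul_of_nonneg_left hi he0.le
        _ = e := mul_one e
    calc d ^ p = (d ^ 2) ^ (p / 2) := by
          rw [← Real.rpow_natCast, ← Real.rpow_mul hd0]
          congr 1; push_cast; ring
      _ ≤ e ^ (p / 2) := Real.rpow_le_rpow (sq_nonneg d) hde (by positivity)
      _ = ε ^ (p + 1) := by
          rw [he, ← Real.rpow_mul hε.le]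
          congr 1; field_simp
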